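/- Let $V$ be a finite non-empty set, $n=|V|$, let $q\ge 1$ be an integer and $[q]=\{0,\dots,q-1\}$, and let $\mu$ be a probability distribution on $[q]^V$ with support $\Omega=\{\sigma\in[q]^V : \mu(\sigma)>0\}$. For $\Lambda\subseteq V$, call $\sigma_\Lambda\in[q]^\Lambda$ feasible if it extends to an element of $\Omega$. For distributions $\alpha,\beta$ on a finite set $S$ let $d_{TV}(\alpha,\beta)=\frac12\sum_{s\in S}|\alpha(s)-\beta(s)|$. For feasible $\sigma_\Lambda$ and $u,v\in V\setminus\Lambda$ let $\mu_v^{\sigma_\Lambda}$ (respectively $\mu_v^{\sigma_\Lambda,u\leftarrow i}$) be the distribution of the value at $v$ under $\mu$ conditioned on the configuration on $\Lambda$ being $\sigma_\Lambda$ (respectively, also on the value at $u$ being $i$), let $\Omega_u^{\sigma_\Lambda}=\{i\in[q] : \mu_u^{\sigma_\Lambda}(i)>0\}$, and define the influence matrix $\Psi_\mu^{\sigma_\Lambda}\in\mathbb{R}^{(V\setminus\Lambda)\times(V\setminus\Lambda)}$ by $$\Psi_\mu^{\sigma_\Lambda}(u,v)=\max_{i,j\in\Omega_u^{\sigma_\Lambda}}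 d_{TV}\big(\mu_v^{\sigma_\Lambda,u\leftarrow i},\mu_v^{\sigma_\Lambda,u\leftarrow j}\big)\quad(u\ne v),\qquad \Psi_\mu^{\sigma_\Lambda}(u,u)=0 .$$ Suppose that there are constants $C\ge 0$ and $0\le\eta<1$ such that for every $0\le k\le n-2$, every $\Lambda\subseteq V$ of size $k$ and every feasible $\sigma_\Lambda\in[q]^\Lambda$, at least one of the following two conditions holds: - (bounded all-to-one influence) $\|\Psi_\mu^{\sigma_\Lambda}\|_1=\max_{v\in V\setminus\Lambda}\sum_{u\in V\setminus\Lambda}\Psi_\mu^{\sigma_\Lambda}(u,v)\le\min\{C,\eta(n-k-1)\}$; - (bounded one-to-all influence) $\|\Psi_\mu^{\sigma_\Lambda}\|_\infty=\max_{u\in V\setminus\Lambda}\sum_{v\in V\setminus\Lambda}\Psi_\mu^{\sigma_\Lambda}(u,v)\le\min\{C,\eta(n-k-1)\}$. Let $P$ be the transition matrix on $\Omega$ of the Glauber dynamics for $\mu$: in each step choose $v\in V$ uniformly at random and resample the value at $v$ from its marginal distribution under $\mu$ conditioned on the current values of all other variables. Then for every $0<\epsilon<1$ the mixing time $$T_{\mathrm{mix}}(\epsilon)=\max_{x\in\Omega}\min\{t\in\mathbb{Z}_{\ge0}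 : d_{TV}(P^t(x,\cdot),\mu)\le\epsilon\}$$ is finite and satisfies $$T_{\mathrm{mix}}(\epsilon)\le\frac{n^{1+2C}}{(1-\eta)^{2+2C}}\,\log\frac{1}{\epsilon\,\mu_{\min}},\qquad \mu_{\min}=\min\{\mu(\sigma) : \sigma\in[q]^V,\ \mu(\sigma)>0\}.$$ -/

import Mathlib

/-! Finite spin systems: conditional marginals, influence matrices, Glauber dynamics and its
mixing time. A configuration is a function `V → Fin q`; a distribution over configurations is
a non-negative function `μ : (V → Fin q) → ℝ` with sum `1`. -/

namespace SpinSystem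

/-- Total variation distance of two (mass functions of) distributions on a finite set. -/
noncomputable def dTV {α : Type*} [Fintype α] (μ ν : α → ℝ) : ℝ :=
  (1 / 2) * ∑ x, |μ x - ν x|

section

variable {V : Type*} [Fintype V] {q : ℕ}

open scoped Classical in
/-- `μ` is (the mass function of) a probability distribution over configurations. -/
def IsDistribution (μ : (V → Fin q) → ℝ) : Prop :=
  (∀ x, 0 ≤ μ x) ∧ ∑ x, μ x = 1

open scoped Classical in
/-- The probability of the event `A`. -/
noncomputable def prob (μ : (V → Fin q) → ℝ) (A : Set (V → Fin q)) : ℝ :=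
  ∑ x, if x ∈ A then μ x else 0

/-- The distribution of the value at `v` under `μ` conditioned on the event `B`
(used only for events `B` of positive probability). -/
noncomputable def condMarginal (μ : (V → Fin q) → ℝ) (B : Set (V → Fin q)) (v : V) :
    Fin q → ℝ :=
  fun c => prob μ ({x | x v = c} ∩ B) / prob μ B

/-- The event that the configuration restricted to `Λ` equals `σ`. -/
def pin {Λ : Finset V} (σ : Λ → Fin q) : Set (V → Fin q) :=
  {x | ∀ w : Λ, x w = σ w}

/-- The partial configuration `σ` extends to a configuration of positive probability. -/
def Feasible (μ : (V → Fin q) → ℝ) {Λ : Finset V} (σ : Λ → Fin q) : Prop :=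
  ∃ x, 0 < μ x ∧ x ∈ pin σ

/-- The possible values of `u` given `σ`. -/
def possibleValues (μ : (V → Fin q) → ℝ) {Λ : Finset V} (σ : Λ → Fin q) (u : V) :
    Set (Fin q) :=
  {i | 0 < condMarginal μ (pin σ) u i}

open scoped Classical in
/-- The influence matrix given `σ`, with rows and columns indexed by the variables outside `Λ`:
the entry at `u ≠ v` is the maximum over possible values `i, j` of `u` of the total variation
distance between the marginals at `v` conditioned on `σ, u ← i` and on `σ, u ← j`. -/
noncomputable def influence (μ : (V → Fin q) → ℝ) {Λ : Finset V} (σ : Λ → Fin q) :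
    Matrix {v : V // v ∉ Λ} {v : V // v ∉ Λ} ℝ :=
  fun u v =>
    if u = v then 0
    else ⨆ p : possibleValues μ σ u × possibleValues μ σ u,
      dTV (condMarginal μ (pin σ ∩ {x | x u = p.1}) v)
        (condMarginal μ (pin σ ∩ {x | x u = p.2}) v)

open scoped Classical in
/-- The all-to-one influence: the maximum column sum (the induced `1`-norm). -/
noncomputable def allToOne (μ : (V → Fin q) → ℝ) {Λ : Finset V} (σ : Λ → Fin q) : ℝ :=
  ⨆ v : {v : V // v ∉ Λ}, ∑ u : {v : V // v ∉ Λ}, influence μ σ u v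

open scoped Classical in
/-- The one-to-all influence: the maximum row sum (the induced `∞`-norm). -/
noncomputable def oneToAll (μ : (V → Fin q) → ℝ) {Λ : Finset V} (σ : Λ → Fin q) : ℝ :=
  ⨆ u : {v : V // v ∉ Λ}, ∑ v : {v : V // v ∉ Λ}, influence μ σ u v

/-- The state space of the dynamics: the configurations of positive probability. -/
abbrev Supp (μ : (V → Fin q) → ℝ) : Type _ := {x : V → Fin q // 0 < μ x}

/-- The minimum positive probability of a configuration. -/
noncomputable def muMin (μ : (V → Fin q) → ℝ) : ℝ := ⨅ x : Supp μ, μ x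

open scoped Classical in
/-- The transition matrix of Glauber dynamics: choose `v` uniformly at random, then resample the
value of `v` from its marginal conditioned on the current values of all other variables. -/
noncomputable def glauber (μ : (V → Fin q) → ℝ) : Matrix (Supp μ) (Supp μ) ℝ :=
  fun x y => (1 / (Fintype.card V : ℝ)) * ∑ v : V,
    if ∀ w, w ≠ v → y.1 w = x.1 w then
      condMarginal μ {z | ∀ w, w ≠ v → z w = x.1 w} v (y.1 v)
    else 0

open scoped Classical in
/-- The mixing time of Glauber dynamics: the maximum over starting states of the first time `t`
at which the total variation distance to `μ` is at most `ε`
(`⊤` if for some starting state there is no such time). -/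
noncomputable def mixingTime (μ : (V → Fin q) → ℝ) (ε : ℝ) : ℕ∞ :=
  ⨆ x : Supp μ, ⨅ t : {t : ℕ // dTV ((glauber μ ^ t) x) (fun y => μ y) ≤ ε}, ((t : ℕ) : ℕ∞)

end

end SpinSystem

/-! The spectral gap is bounded below by a local-to-global induction over pinnings. Under a fixed
pinning, take the operator that sends single-site functions to their centred conditional
expectations given a different site. It is self-adjoint, so its largest eigenvalue controls all
pairwise correlations. For an eigenfunction with eigenvalue `c`, the oscillations over the possible
values of each site form a vector `o ≥ 0` with `c o ≤ Ψ o`. If `c` exceeds the row-sum or the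
column-sum norm of `Ψ`, then `o = 0`, the eigenfunction is constant at each site, and centring
annihilates it (`eigenfunction_eq_zero`). Either norm serves, so the choice may vary with the
pinning.

By duality, the conditional expectations of any `f` given single sites carry in total at most `1 +
ρ` times its variance (`sum_varOn_sub_le`). With `k + 1` free sites and `ρ = k min(C/k, η)`,
revealing a uniformly random site keeps on average at least `k/(k+1) · (1 - min(C/k, η))` of the
variance. Iterating down to one free site gives a gap of at least `(1/n) ∏_{k<n} (1 - min(C/k, η))`
(`prod_mul_varOn_le`, `glauber_gap`). Factors with large `k` are compared with the telescoping `(1 -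
1/k)^(2C)`, the others with `1 - η` (`rpow_min_le_prod`).

Heat-bath updates are orthogonal projections, so the chain has a nonnegative form and the gap alone
gives geometric decay in `L²`, hence in total variation (`dTV_pow_le`). -/

namespace SpinSystem

/-! ### Spectral bound on correlations from row or column sums of influences. -/

section Spectral

open Matrix

/-- A real symmetric matrix without eigenvalues above `ρ` has quadratic form at most `ρ ‖x‖²`. -/
theorem dotProduct_mulVec_le_of_eigenvectors {n : Type*} [Fintype n] {S : Matrix n n ℝ}
    (hS : S.IsHermitian) {ρ : ℝ}
    (h : ∀ (c : ℝ) (x : n → ℝ), ρ < c → S *ᵥ x = c • x → x = 0) (x : n → ℝ) :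
    x ⬝ᵥ S *ᵥ x ≤ ρ * (x ⬝ᵥ x) := by
  classical
  have hA : (ρ • (1 : Matrix n n ℝ) - S).IsHermitian := by
    refine IsHermitian.sub ?_ hS
    ext i j
    by_cases hij : i = j
    · subst hij; simp
    · simp [hij, Ne.symm hij]
  have hpos : (ρ • (1 : Matrix n n ℝ) - S).PosSemidef := by
    rw [hA.posSemidef_iff_eigenvalues_nonneg]
    intro j
    by_contra hneg
    have hneg' : hA.eigenvalues j < 0 := not_le.mp hneg
    have he := hA.mulVec_eigenvectorBasis j
    -- A negative eigenvalue `l` of `ρ - S` is an eigenvalue `ρ - l > ρ` of `S`.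
    have h0 := h (ρ - hA.eigenvalues j) (hA.eigenvectorBasis j).ofLp (by linarith) (by
      rw [sub_mulVec, smul_mulVec, one_mulVec] at he
      have he' : S *ᵥ (hA.eigenvectorBasis j).ofLp = ρ • (hA.eigenvectorBasis j).ofLp
          - hA.eigenvalues j • (hA.eigenvectorBasis j).ofLp := by
        simp only [← he]; abel
      rw [he', sub_smul])
    have h1 := hA.eigenvectorBasis.orthonormal.1 j
    have h2 : hA.eigenvectorBasis j = 0 := by
      ext i; exact congrFun h0 i
    rw [h2] at h1
    simp at h1
  have := hpos.dotProduct_mulVec_nonneg x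
  rw [star_trivial, sub_mulVec, smul_mulVec, one_mulVec, dotProduct_sub, dotProduct_smul,
    smul_eq_mul] at this
  linarith

/-- Integrating a function whose values on the support of a signed measure of total mass zero lie
in an interval. -/
theorem sum_mul_le_of_sum_eq_zero {A : Type*} [Fintype A] (d g : A → ℝ) (a b : ℝ)
    (hd : ∑ i, d i = 0) (hg : ∀ i, d i ≠ 0 → a ≤ g i ∧ g i ≤ b) :
    ∑ i, d i * g i ≤ (1 / 2 * ∑ i, |d i|) * (b - a) := by
  -- Total mass zero allows recentring `g` at the midpoint, where it is at most half the interval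
  -- length in absolute value.
  have h1 : ∑ i, d i * g i = ∑ i, d i * (g i - (a + b) / 2) := by
    simp only [mul_sub, Finset.sum_sub_distrib, ← Finset.sum_mul, hd]; ring
  have h2 : (1 / 2 * ∑ i, |d i|) * (b - a) = ∑ i, |d i| * ((b - a) / 2) := by
    rw [← Finset.sum_mul]; ring
  rw [h1, h2]
  refine Finset.sum_le_sum fun i _ => ?_
  by_cases h0 : d i = 0
  · simp [h0]
  obtain ⟨h3, h4⟩ := hg i h0
  refine (le_abs_self _).trans ?_
  rw [abs_mul]
  exact mul_le_mul_of_nonneg_left (abs_le.2 ⟨by linarith, by linarith⟩) (abs_nonneg _)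

/-- A nonnegative vector `o` with `c • o ≤ R o` vanishes if `c` exceeds the maximum row sum or the
maximum column sum of the nonnegative matrix `R`. -/
theorem eq_zero_of_mul_le_sum {ι : Type*} [Fintype ι] (R : ι → ι → ℝ) (hR : ∀ u v, 0 ≤ R u v)
    {ρ c : ℝ} (hc : ρ < c) (hsum : (∀ u, ∑ v, R u v ≤ ρ) ∨ (∀ v, ∑ u, R u v ≤ ρ))
    (o : ι → ℝ) (ho : ∀ u, 0 ≤ o u) (h : ∀ u, c * o u ≤ ∑ v, R u v * o v) (u : ι) : o u = 0 := by
  -- Row sums: test the inequality at a maximal coordinate of `o`. Column sums: add it over all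
  -- coordinates.
  rcases hsum with hrow | hcol
  · obtain ⟨m, -, hm⟩ := Finset.exists_max_image Finset.univ o ⟨u, Finset.mem_univ u⟩
    have h1 : ∑ v, R m v * o v ≤ ρ * o m := by
      calc ∑ v, R m v * o v ≤ ∑ v, R m v * o m :=
            Finset.sum_le_sum fun v hv => mul_le_mul_of_nonneg_left (hm v hv) (hR m v)
        _ = (∑ v, R m v) * o m := by rw [Finset.sum_mul]
        _ ≤ ρ * o m := mul_le_mul_of_nonneg_right (hrow m) (ho m)
    have h2 : o m ≤ 0 := by nlinarith [h m, ho m]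
    exact le_antisymm ((hm u (Finset.mem_univ u)).trans h2) (ho u)
  · have h1 : c * ∑ u, o u ≤ ρ * ∑ u, o u := by
      calc c * ∑ u, o u = ∑ u, c * o u := by rw [Finset.mul_sum]
        _ ≤ ∑ u, ∑ v, R u v * o v := Finset.sum_le_sum fun u _ => h u
        _ = ∑ v, (∑ u, R u v) * o v := by
            rw [Finset.sum_comm]; simp only [Finset.sum_mul]
        _ ≤ ∑ v, ρ * o v :=
            Finset.sum_le_sum fun v _ => mul_le_mul_of_nonneg_right (hcol v) (ho v)
        _ = ρ * ∑ u, o u := by rw [Finset.mul_sum]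
    have h2 : 0 ≤ ∑ u, o u := Finset.sum_nonneg fun u _ => ho u
    have h3 : ∑ u, o u = 0 := by nlinarith
    exact (Finset.sum_eq_zero_iff_of_nonneg fun u _ => ho u).1 h3 u (Finset.mem_univ u)

variable {ι A : Type*} [Fintype ι] [DecidableEq ι] [Fintype A]

/-- Eigenfunctions of the centred conditional expectation operator between distinct sites vanish
for eigenvalues above the row-sum or column-sum norm of an influence matrix. -/
theorem eigenfunction_eq_zero (p : ι → A → ℝ) (hp : ∀ u i, 0 ≤ p u i) {Z : ℝ} (hZ : 0 < Z)
    (hpZ : ∀ u, ∑ i, p u i = Z) (J : ι → A → ι → A → ℝ)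
    (hJsum : ∀ u v, u ≠ v → ∀ i, ∑ j, J u i v j = p u i)
    (hJ0 : ∀ u i v j, p v j = 0 → J u i v j = 0)
    (R : ι → ι → ℝ) (hR : ∀ u v, 0 ≤ R u v)
    (hinf : ∀ u v, u ≠ v → ∀ i i', 0 < p u i → 0 < p u i' →
      1 / 2 * ∑ j, |J u i v j / p u i - J u i' v j / p u i'| ≤ R u v)
    {ρ c : ℝ} (hρ : 0 ≤ ρ) (hc : ρ < c)
    (hsum : (∀ u, ∑ v, R u v ≤ ρ) ∨ (∀ v, ∑ u, R u v ≤ ρ))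
    (g : ι → A → ℝ)
    (hg : ∀ u i, 0 < p u i → c * g u i =
      ∑ v, if u = v then 0 else ∑ j, (J u i v j / p u i - p v j / Z) * g v j)
    (u : ι) (i : A) (hi : 0 < p u i) : g u i = 0 := by
  have hc0 : 0 < c := hρ.trans_lt hc
  have hne : ∀ u, (Finset.univ.filter fun i => 0 < p u i).Nonempty := by
    intro u
    obtain ⟨i, -, hi⟩ := Finset.exists_ne_zero_of_sum_ne_zero ((hpZ u).trans_ne hZ.ne')
    exact ⟨i, by simpa using lt_of_le_of_ne (hp u i) (Ne.symm hi)⟩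
  choose a ha ha' using fun u => Finset.exists_min_image _ (g u) (hne u)
  choose b hb hb' using fun u => Finset.exists_max_image _ (g u) (hne u)
  simp only [Finset.mem_filter, Finset.mem_univ, true_and] at ha ha' hb hb'
  have hQ : ∀ u v, u ≠ v → ∀ i, 0 < p u i → ∑ j, J u i v j / p u i = 1 := by
    intro u v huv i hi
    rw [← Finset.sum_div, hJsum u v huv i, div_self hi.ne']
  have hosc : ∀ u, g u (b u) - g u (a u) = 0 := by
    refine eq_zero_of_mul_le_sum R hR hc hsum _ (fun u => sub_nonneg.2 (ha' u _ (hb u))) ?_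
    intro u
    -- Subtracting the equations at the maximiser and the minimiser cancels the centring terms `p v
    -- j / Z`; what remains is a difference of two conditional laws, whose total variation is an
    -- influence.
    rw [mul_sub, hg u _ (hb u), hg u _ (ha u), ← Finset.sum_sub_distrib]
    refine Finset.sum_le_sum fun v _ => ?_
    by_cases huv : u = v
    · subst huv
      simpa using mul_nonneg (hR u u) (sub_nonneg.2 (ha' u _ (hb u)))
    rw [if_neg huv, if_neg huv, ← Finset.sum_sub_distrib]
    have h1 := sum_mul_le_of_sum_eq_zero
      (fun j => J u (b u) v j / p u (b u) - J u (a u) v j / p u (a u)) (g v)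
      (g v (a v)) (g v (b v))
      (by rw [Finset.sum_sub_distrib, hQ u v huv _ (hb u), hQ u v huv _ (ha u), sub_self])
      (by
        intro j hj
        have hpj : 0 < p v j := by
          refine lt_of_le_of_ne (hp v j) fun h0 => hj ?_
          simp [hJ0 u _ v j h0.symm]
        exact ⟨ha' v j hpj, hb' v j hpj⟩)
    refine le_trans (le_of_eq ?_) (h1.trans (mul_le_mul_of_nonneg_right
      (hinf u v huv _ _ (hb u) (ha u)) (sub_nonneg.2 (ha' v _ (hb v)))))
    refine Finset.sum_congr rfl fun j _ => ?_
    ring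
  have hconst : ∀ v j, 0 < p v j → g v j = g v (a v) := fun v j hj =>
    le_antisymm ((hb' v j hj).trans (sub_nonpos.1 (hosc v).le)) (ha' v j hj)
  have h0 : c * g u i = 0 := by
    rw [hg u i hi]
    refine Finset.sum_eq_zero fun v _ => ?_
    by_cases huv : u = v
    · rw [if_pos huv]
    rw [if_neg huv]
    have h1 : ∀ j, (J u i v j / p u i - p v j / Z) * g v j
        = (J u i v j / p u i - p v j / Z) * g v (a v) := by
      intro j
      rcases (hp v j).eq_or_lt with h | h
      · simp [hJ0 u i v j h.symm, h.symm]
      · rw [hconst v j h]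
    simp only [h1]
    rw [← Finset.sum_mul, Finset.sum_sub_distrib, hQ u v huv i hi, ← Finset.sum_div, hpZ v,
      div_self hZ.ne']
    simp
  exact (mul_eq_zero.1 h0).resolve_left hc0.ne'

/-- The pairwise correlations of centred single-site functions are bounded by the row-sum or
column-sum norm of the influence matrix. -/
theorem sum_pair_correlation_le (p : ι → A → ℝ) (hp : ∀ u i, 0 ≤ p u i) {Z : ℝ} (hZ : 0 < Z)
    (hpZ : ∀ u, ∑ i, p u i = Z) (J : ι → A → ι → A → ℝ)
    (hJsymm : ∀ u i v j, J u i v j = J v j u i)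
    (hJsum : ∀ u v, u ≠ v → ∀ i, ∑ j, J u i v j = p u i)
    (hJ0 : ∀ u i v j, p v j = 0 → J u i v j = 0)
    (R : ι → ι → ℝ) (hR : ∀ u v, 0 ≤ R u v)
    (hinf : ∀ u v, u ≠ v → ∀ i i', 0 < p u i → 0 < p u i' →
      1 / 2 * ∑ j, |J u i v j / p u i - J u i' v j / p u i'| ≤ R u v)
    {ρ : ℝ} (hρ : 0 ≤ ρ)
    (hsum : (∀ u, ∑ v, R u v ≤ ρ) ∨ (∀ v, ∑ u, R u v ≤ ρ))
    (g : ι → A → ℝ) (hg : ∀ u, ∑ i, p u i * g u i = 0) :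
    ∑ u, ∑ v, (if u = v then 0 else ∑ i, ∑ j, J u i v j * g u i * g v j)
      ≤ ρ * ∑ u, ∑ i, p u i * g u i ^ 2 := by
  -- Conjugating the operator by `√p` makes it symmetric. Division by zero being zero, rows and
  -- columns of impossible values vanish.
  let S : Matrix (ι × A) (ι × A) ℝ := fun a b =>
    (if a.1 = b.1 then 0 else J a.1 a.2 b.1 b.2 - p a.1 a.2 * p b.1 b.2 / Z)
      / (√(p a.1 a.2) * √(p b.1 b.2))
  have hS : S.IsHermitian := by
    ext a b
    rw [conjTranspose_apply, star_trivial]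
    simp only [S]
    rw [mul_comm (√(p b.1 b.2)), hJsymm b.1 b.2]
    congr 1
    by_cases h : a.1 = b.1
    · rw [if_pos h, if_pos h.symm]
    · rw [if_neg h, if_neg (Ne.symm h)]; ring
  have hsq : ∀ u i, √(p u i) * √(p u i) = p u i := fun u i => Real.mul_self_sqrt (hp u i)
  have hev : ∀ (c : ℝ) (x : ι × A → ℝ), ρ < c → S *ᵥ x = c • x → x = 0 := by
    intro c x hc hx
    have hc0 : 0 < c := hρ.trans_lt hc
    have hx' : ∀ u i, c * x (u, i) = ∑ v, ∑ j, S (u, i) (v, j) * x (v, j) := by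
      intro u i
      have := congrFun hx (u, i)
      rw [Pi.smul_apply, smul_eq_mul] at this
      rw [← this, mulVec, dotProduct, Fintype.sum_prod_type]
    have h0 : ∀ u i, p u i = 0 → x (u, i) = 0 := by
      intro u i h
      have h1 := hx' u i
      have h2 : c * x (u, i) = 0 := by
        rw [h1]
        exact Finset.sum_eq_zero fun v _ => Finset.sum_eq_zero fun j _ => by simp [S, h]
      exact (mul_eq_zero.1 h2).resolve_left hc0.ne'
    have key := eigenfunction_eq_zero p hp hZ hpZ J hJsum hJ0 R hR hinf hρ hc hsum
      (fun u i => x (u, i) / √(p u i)) (by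
        intro u i hi
        have hs : √(p u i) ≠ 0 := (Real.sqrt_pos.2 hi).ne'
        rw [← mul_div_assoc, hx', Finset.sum_div]
        refine Finset.sum_congr rfl fun v _ => ?_
        by_cases huv : u = v
        · simp [S, huv]
        rw [if_neg huv, Finset.sum_div]
        refine Finset.sum_congr rfl fun j _ => ?_
        simp only [S, if_neg huv]
        rcases (hp v j).eq_or_lt with h | h
        · simp [h.symm]
        have hs' : √(p v j) ≠ 0 := (Real.sqrt_pos.2 h).ne'
        have e1 : J u i v j / p u i - p v j / Z
            = (J u i v j - p u i * p v j / Z) / (√(p u i) * √(p u i)) := by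
          rw [hsq]; field_simp
        rw [e1]
        field_simp)
    ext ⟨u, i⟩
    rcases (hp u i).eq_or_lt with h | h
    · exact h0 u i h.symm
    · exact (div_eq_zero_iff.1 (key u i h)).resolve_right (Real.sqrt_pos.2 h).ne'
  have hquad := dotProduct_mulVec_le_of_eigenvectors hS hev (fun a => √(p a.1 a.2) * g a.1 a.2)
  have hr : (fun a : ι × A => √(p a.1 a.2) * g a.1 a.2) ⬝ᵥ
      (fun a : ι × A => √(p a.1 a.2) * g a.1 a.2) = ∑ u, ∑ i, p u i * g u i ^ 2 := by
    rw [dotProduct, Fintype.sum_prod_type]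
    refine Finset.sum_congr rfl fun u _ => Finset.sum_congr rfl fun i _ => ?_
    linear_combination (g u i ^ 2) * hsq u i
  rw [hr] at hquad
  refine le_trans (le_of_eq ?_) hquad
  simp only [dotProduct, mulVec, Fintype.sum_prod_type, Finset.mul_sum]
  refine Finset.sum_congr rfl fun u _ => ?_
  rw [Finset.sum_comm]
  refine Finset.sum_congr rfl fun v _ => ?_
  by_cases huv : u = v
  · simp [S, huv]
  -- Centred `g` do not see the product term subtracted in `S`.
  have hz : ∑ i, ∑ j, (p u i * p v j / Z) * g u i * g v j = 0 := by
    have : ∀ i j, (p u i * p v j / Z) * g u i * g v j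
        = (p u i * g u i / Z) * (p v j * g v j) := fun i j => by ring
    simp only [this, ← Finset.mul_sum, hg v, mul_zero, Finset.sum_const_zero]
  rw [if_neg huv, ← sub_zero (∑ i, ∑ j, _), ← hz, ← Finset.sum_sub_distrib]
  refine Finset.sum_congr rfl fun i _ => ?_
  rw [← Finset.sum_sub_distrib]
  refine Finset.sum_congr rfl fun j _ => ?_
  simp only [S, if_neg huv]
  rcases (hp u i).eq_or_lt with h | h
  · simp [hJsymm u i v j, hJ0 v j u i h.symm, h.symm]
  rcases (hp v j).eq_or_lt with h' | h'
  · simp [hJ0 u i v j h'.symm, h'.symm]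
  have hs : √(p u i) ≠ 0 := (Real.sqrt_pos.2 h).ne'
  have hs' : √(p v j) ≠ 0 := (Real.sqrt_pos.2 h').ne'
  field_simp

end Spectral

/-! ### Unnormalised variances on events and the duality estimate. -/

section Variance

variable {V : Type*} [Fintype V] {q : ℕ}

open scoped Classical in
/-- The sum of a function over an event. -/
noncomputable def sumOn (B : Set (V → Fin q)) (F : (V → Fin q) → ℝ) : ℝ :=
  ∑ x, if x ∈ B then F x else 0

theorem prob_eq_sumOn (μ : (V → Fin q) → ℝ) (B : Set (V → Fin q)) : prob μ B = sumOn B μ := rfl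

theorem sumOn_congr {B : Set (V → Fin q)} {F G : (V → Fin q) → ℝ} (h : ∀ x ∈ B, F x = G x) :
    sumOn B F = sumOn B G := by
  classical
  refine Finset.sum_congr rfl fun x _ => ?_
  by_cases hx : x ∈ B
  · simp [hx, h x hx]
  · simp [hx]

theorem sumOn_add (B : Set (V → Fin q)) (F G : (V → Fin q) → ℝ) :
    sumOn B (fun x => F x + G x) = sumOn B F + sumOn B G := by
  classical
  rw [sumOn, sumOn, sumOn, ← Finset.sum_add_distrib]
  refine Finset.sum_congr rfl fun x _ => ?_
  split_ifs <;> simp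

theorem sumOn_mul_left (B : Set (V → Fin q)) (c : ℝ) (F : (V → Fin q) → ℝ) :
    sumOn B (fun x => c * F x) = c * sumOn B F := by
  classical
  rw [sumOn, sumOn, Finset.mul_sum]
  refine Finset.sum_congr rfl fun x _ => ?_
  split_ifs <;> simp

theorem sumOn_sum {ι : Type*} (s : Finset ι) (B : Set (V → Fin q)) (F : ι → (V → Fin q) → ℝ) :
    sumOn B (fun x => ∑ i ∈ s, F i x) = ∑ i ∈ s, sumOn B (F i) := by
  classical
  simp only [sumOn]
  rw [Finset.sum_comm]
  refine Finset.sum_congr rfl fun x _ => ?_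
  split_ifs <;> simp

theorem sumOn_nonneg {B : Set (V → Fin q)} {F : (V → Fin q) → ℝ} (h : ∀ x ∈ B, 0 ≤ F x) :
    0 ≤ sumOn B F := by
  classical
  refine Finset.sum_nonneg fun x _ => ?_
  split_ifs with hx
  · exact h x hx
  · exact le_rfl

/-- Splitting an event according to the value at a site. -/
theorem sum_sumOn_fiber (B : Set (V → Fin q)) (u : V) (F : Fin q → (V → Fin q) → ℝ) :
    ∑ i, sumOn (B ∩ {x | x u = i}) (F i) = sumOn B (fun x => F (x u) x) := by
  classical
  simp only [sumOn]
  rw [Finset.sum_comm]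
  refine Finset.sum_congr rfl fun x _ => ?_
  rw [Finset.sum_eq_single (x u)]
  · simp
  · intro i _ hi
    simp [Ne.symm hi]
  · simp

theorem sumOn_mul_eq_zero {μ : (V → Fin q) → ℝ} (hμ : ∀ x, 0 ≤ μ x) {B : Set (V → Fin q)}
    (hB : prob μ B = 0) (f : (V → Fin q) → ℝ) : sumOn B (fun x => μ x * f x) = 0 := by
  classical
  refine Finset.sum_eq_zero fun x _ => ?_
  have h := (Finset.sum_eq_zero_iff_of_nonneg (fun x _ => by
    split_ifs
    · exact hμ x
    · exact le_rfl)).1 hB x (Finset.mem_univ x)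
  split_ifs with hx
  · rw [if_pos hx] at h; simp [h]
  · rfl

theorem prob_nonneg {μ : (V → Fin q) → ℝ} (hμ : ∀ x, 0 ≤ μ x) (B : Set (V → Fin q)) :
    0 ≤ prob μ B := sumOn_nonneg fun x _ => hμ x

theorem prob_mono {μ : (V → Fin q) → ℝ} (hμ : ∀ x, 0 ≤ μ x) {B B' : Set (V → Fin q)}
    (h : B ⊆ B') : prob μ B ≤ prob μ B' := by
  classical
  refine Finset.sum_le_sum fun x _ => ?_
  by_cases hx : x ∈ B
  · simp [hx, h hx]
  · simp only [hx, if_false]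
    split_ifs
    · exact hμ x
    · exact le_rfl

/-- The variance of `f` on the event `B`, scaled by the probability of `B`. -/
noncomputable def varOn (μ : (V → Fin q) → ℝ) (B : Set (V → Fin q)) (f : (V → Fin q) → ℝ) : ℝ :=
  sumOn B (fun x => μ x * f x ^ 2) - sumOn B (fun x => μ x * f x) ^ 2 / prob μ B

theorem varOn_eq_zero {μ : (V → Fin q) → ℝ} (hμ : ∀ x, 0 ≤ μ x) {B : Set (V → Fin q)}
    (hB : prob μ B = 0) (f : (V → Fin q) → ℝ) : varOn μ B f = 0 := by
  rw [varOn, sumOn_mul_eq_zero hμ hB, sumOn_mul_eq_zero hμ hB]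
  simp

theorem varOn_sub_const {μ : (V → Fin q) → ℝ} (hμ : ∀ x, 0 ≤ μ x) (B : Set (V → Fin q))
    (f : (V → Fin q) → ℝ) (c : ℝ) : varOn μ B (fun x => f x - c) = varOn μ B f := by
  rcases eq_or_ne (prob μ B) 0 with hB | hB
  · rw [varOn_eq_zero hμ hB, varOn_eq_zero hμ hB]
  have h1 : sumOn B (fun x => μ x * (f x - c) ^ 2) = sumOn B (fun x => μ x * f x ^ 2)
      + ((-2 * c) * sumOn B (fun x => μ x * f x) + c ^ 2 * prob μ B) := by
    rw [prob_eq_sumOn, ← sumOn_mul_left, ← sumOn_mul_left, ← sumOn_add, ← sumOn_add]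
    exact sumOn_congr fun x _ => by ring
  have h2 : sumOn B (fun x => μ x * (f x - c)) = sumOn B (fun x => μ x * f x)
      + (-c) * prob μ B := by
    rw [prob_eq_sumOn, ← sumOn_mul_left, ← sumOn_add]
    exact sumOn_congr fun x _ => by ring
  rw [varOn, varOn, h1, h2]
  field_simp
  ring

/-- If the pairwise correlations on `B` of centred single-site functions are bounded by `ρ`, then
the expectations of a function given a single site carry, in total, at most `1 + ρ` times its
variance. -/
theorem sum_varOn_sub_le {μ : (V → Fin q) → ℝ} (hμ : ∀ x, 0 ≤ μ x) {B : Set (V → Fin q)}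
    (hB : 0 < prob μ B) {ι : Type*} [Fintype ι] [DecidableEq ι] (s : ι → V) {ρ : ℝ} (hρ : 0 ≤ ρ)
    (hcorr : ∀ g : ι → Fin q → ℝ,
      (∀ u, ∑ i, prob μ (B ∩ {x | x (s u) = i}) * g u i = 0) →
      ∑ u, ∑ v, (if u = v then 0 else
        ∑ i, ∑ j, prob μ ({x | x (s v) = j} ∩ (B ∩ {x | x (s u) = i})) * g u i * g v j)
        ≤ ρ * ∑ u, ∑ i, prob μ (B ∩ {x | x (s u) = i}) * g u i ^ 2)
    (f : (V → Fin q) → ℝ) :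
    ∑ u, (varOn μ B f - ∑ i, varOn μ (B ∩ {x | x (s u) = i}) f) ≤ (1 + ρ) * varOn μ B f := by
  obtain ⟨f', hf'⟩ : ∃ f' : (V → Fin q) → ℝ,
      f' = fun x => f x - sumOn B (fun x => μ x * f x) / prob μ B := ⟨_, rfl⟩
  have hvar : ∀ D, varOn μ D f = varOn μ D f' := fun D => by rw [hf', varOn_sub_const hμ]
  have hmean : sumOn B (fun x => μ x * f' x) = 0 := by
    have : sumOn B (fun x => μ x * f' x) = sumOn B (fun x => μ x * f x)
        + (-(sumOn B (fun x => μ x * f x) / prob μ B)) * prob μ B := by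
      rw [prob_eq_sumOn, ← sumOn_mul_left, ← sumOn_add]
      exact sumOn_congr fun x _ => by rw [hf', prob_eq_sumOn]; ring
    rw [this]
    field_simp
    ring
  simp only [hvar]
  set p : ι → Fin q → ℝ := fun u i => prob μ (B ∩ {x | x (s u) = i}) with hp
  -- The conditional expectation of the centred `f'` given the value at a site, with value 0 on null
  -- events.
  set g : ι → Fin q → ℝ := fun u i =>
    sumOn (B ∩ {x | x (s u) = i}) (fun x => μ x * f' x) / p u i with hg
  have hpg : ∀ u i, p u i * g u i = sumOn (B ∩ {x | x (s u) = i}) (fun x => μ x * f' x) := by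
    intro u i
    rcases eq_or_ne (p u i) 0 with h | h
    · rw [sumOn_mul_eq_zero hμ h, h, zero_mul]
    · simp only [hg]; field_simp
  have hcorr' := hcorr g (fun u => by
    have := sum_sumOn_fiber B (s u) (fun _ x => μ x * f' x)
    rw [hmean] at this
    rw [← this]
    exact Finset.sum_congr rfl fun i _ => hpg u i)
  have hA : ∀ u, varOn μ B f' - ∑ i, varOn μ (B ∩ {x | x (s u) = i}) f'
      = ∑ i, p u i * g u i ^ 2 := by
    intro u
    simp only [varOn]
    rw [hmean, Finset.sum_sub_distrib, sum_sumOn_fiber B (s u) (fun _ x => μ x * f' x ^ 2)]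
    have : ∀ i, sumOn (B ∩ {x | x (s u) = i}) (fun x => μ x * f' x) ^ 2
        / prob μ (B ∩ {x | x (s u) = i}) = p u i * g u i ^ 2 := by
      intro i
      rw [← hpg]
      change (p u i * g u i) ^ 2 / p u i = _
      rcases eq_or_ne (p u i) 0 with h | h
      · simp [h]
      · field_simp
    simp only [this]
    ring
  simp only [hA]
  -- Here `⟨f', G⟩ = E`, while the correlation bound gives `‖G‖² ≤ (1 + ρ) E`: the diagonal
  -- contributes `E`, the rest at most `ρ E`.
  set G : (V → Fin q) → ℝ := fun x => ∑ u, g u (x (s u)) with hG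
  set E : ℝ := ∑ u, ∑ i, p u i * g u i ^ 2 with hE
  have hcross : sumOn B (fun x => μ x * f' x * G x) = E := by
    have h1 : sumOn B (fun x => μ x * f' x * G x)
        = sumOn B (fun x => ∑ u, g u (x (s u)) * (μ x * f' x)) :=
      sumOn_congr fun x _ => by rw [hG, ← Finset.sum_mul, mul_comm]
    rw [h1, sumOn_sum]
    refine Finset.sum_congr rfl fun u _ => ?_
    rw [← sum_sumOn_fiber B (s u) (fun i x => g u i * (μ x * f' x))]
    refine Finset.sum_congr rfl fun i _ => ?_
    rw [sumOn_mul_left, ← hpg]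
    ring
  have hGG : sumOn B (fun x => μ x * G x ^ 2) ≤ (1 + ρ) * E := by
    have h1 : sumOn B (fun x => μ x * G x ^ 2)
        = sumOn B (fun x => ∑ u, ∑ v, μ x * g u (x (s u)) * g v (x (s v))) := by
      refine sumOn_congr fun x _ => ?_
      rw [hG, sq, Finset.sum_mul_sum, Finset.mul_sum]
      refine Finset.sum_congr rfl fun u _ => ?_
      rw [Finset.mul_sum]
      exact Finset.sum_congr rfl fun v _ => by ring
    have hdiag : ∀ u, sumOn B (fun x => μ x * g u (x (s u)) * g u (x (s u)))
        = ∑ i, p u i * g u i ^ 2 := by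
      intro u
      rw [← sum_sumOn_fiber B (s u) (fun i x => μ x * g u i * g u i)]
      refine Finset.sum_congr rfl fun i _ => ?_
      rw [hp]
      simp only [prob_eq_sumOn]
      rw [mul_comm, ← sumOn_mul_left]
      exact sumOn_congr fun x _ => by ring
    have hoff : ∀ u v, sumOn B (fun x => μ x * g u (x (s u)) * g v (x (s v)))
        = ∑ i, ∑ j, prob μ ({x | x (s v) = j} ∩ (B ∩ {x | x (s u) = i})) * g u i * g v j := by
      intro u v
      rw [← sum_sumOn_fiber B (s u) (fun i x => μ x * g u i * g v (x (s v)))]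
      refine Finset.sum_congr rfl fun i _ => ?_
      rw [← sum_sumOn_fiber _ (s v) (fun j x => μ x * g u i * g v j)]
      refine Finset.sum_congr rfl fun j _ => ?_
      rw [Set.inter_comm, prob_eq_sumOn, mul_assoc, mul_comm, ← sumOn_mul_left]
      exact sumOn_congr fun x _ => by ring
    have h2 : sumOn B (fun x => μ x * G x ^ 2) = E + ∑ u, ∑ v, (if u = v then 0 else
        ∑ i, ∑ j, prob μ ({x | x (s v) = j} ∩ (B ∩ {x | x (s u) = i})) * g u i * g v j) := by
      rw [h1, sumOn_sum, hE, ← Finset.sum_add_distrib]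
      refine Finset.sum_congr rfl fun u _ => ?_
      rw [sumOn_sum, ← hdiag]
      rw [← Finset.add_sum_erase _ _ (Finset.mem_univ u)]
      congr 1
      rw [← Finset.add_sum_erase _ (fun v => if u = v then _ else _) (Finset.mem_univ u), if_pos rfl,
        zero_add]
      refine Finset.sum_congr rfl fun v hv => ?_
      rw [if_neg (Finset.ne_of_mem_erase hv).symm, hoff]
    rw [h2]
    linarith [hcorr']
  have hv : varOn μ B f' = sumOn B (fun x => μ x * f' x ^ 2) := by
    rw [varOn, hmean]; simp
  -- Cauchy–Schwarz in the form `‖(1 + ρ) f' - G‖² ≥ 0`, which avoids dividing by `E`.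
  have hsq : 0 ≤ (1 + ρ) ^ 2 * varOn μ B f' + (-(2 * (1 + ρ)) * E
      + sumOn B (fun x => μ x * G x ^ 2)) := by
    rw [hv, ← hcross, ← sumOn_mul_left, ← sumOn_mul_left, ← sumOn_add, ← sumOn_add]
    refine sumOn_nonneg fun x _ => ?_
    have := mul_nonneg (hμ x) (sq_nonneg ((1 + ρ) * f' x - G x))
    linarith
  have h3 : 0 ≤ (1 + ρ) * ((1 + ρ) * varOn μ B f' - E) := by nlinarith
  exact sub_nonneg.1 (nonneg_of_mul_nonneg_right h3 (by linarith))

end Variance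

/-! ### Cylinder events and single-site lines. -/

section Cylinders

variable {V : Type*} {q : ℕ}

/-- The configurations that agree with `x` on `Λ`. -/
def cyl (Λ : Finset V) (x : V → Fin q) : Set (V → Fin q) := {y | ∀ w ∈ Λ, y w = x w}

/-- The configurations that agree with `x` off the site `v`. -/
def line (v : V) (x : V → Fin q) : Set (V → Fin q) := {y | ∀ w, w ≠ v → y w = x w}

theorem line_eq_of_mem {v : V} {x y : V → Fin q} (h : y ∈ line v x) : line v y = line v x := by
  ext z
  exact forall₂_congr fun w hw => by rw [h w hw]

theorem mem_line_comm {v : V} {x y : V → Fin q} : y ∈ line v x ↔ x ∈ line v y :=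
  forall₂_congr fun _ _ => eq_comm

theorem mem_line_self (v : V) (x : V → Fin q) : x ∈ line v x := fun _ _ => rfl

theorem cyl_eq_pin (Λ : Finset V) (x : V → Fin q) : cyl Λ x = pin (fun w : Λ => x w) := by
  ext y
  simp [cyl, pin]

theorem cyl_inter [DecidableEq V] (Λ : Finset V) (x : V → Fin q) {u : V} (hu : u ∉ Λ) (i : Fin q) :
    cyl Λ x ∩ {y | y u = i} = cyl (insert u Λ) (Function.update x u i) := by
  ext y
  simp only [cyl, Set.mem_inter_iff, Set.mem_ofPred_eq, Finset.forall_mem_insert,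
    Function.update_self]
  rw [and_comm]
  refine and_congr Iff.rfl (forall₂_congr fun w hw => ?_)
  rw [Function.update_of_ne (fun h : w = u => hu (h ▸ hw))]

end Cylinders

/-! ### From influence bounds to a Poincaré inequality. -/

section LocalToGlobal

variable {V : Type*} [Fintype V] {q : ℕ}

theorem dTV_nonneg {α : Type*} [Fintype α] (f g : α → ℝ) : 0 ≤ dTV f g :=
  mul_nonneg (by norm_num) (Finset.sum_nonneg fun _ _ => abs_nonneg _)

theorem influence_nonneg (μ : (V → Fin q) → ℝ) {Λ : Finset V} (σ : Λ → Fin q)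
    (u v : {v : V // v ∉ Λ}) : 0 ≤ influence μ σ u v := by
  rw [influence]
  split_ifs
  · exact le_rfl
  · exact Real.iSup_nonneg fun _ => dTV_nonneg _ _

theorem dTV_le_influence (μ : (V → Fin q) → ℝ) {Λ : Finset V} (σ : Λ → Fin q)
    {u v : {v : V // v ∉ Λ}} (huv : u ≠ v) {i j : Fin q}
    (hi : i ∈ possibleValues μ σ u) (hj : j ∈ possibleValues μ σ u) :
    dTV (condMarginal μ (pin σ ∩ {x | x u = i}) v) (condMarginal μ (pin σ ∩ {x | x u = j}) v)
      ≤ influence μ σ u v := by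
  rw [influence, if_neg huv]
  exact le_ciSup (f := fun p : possibleValues μ σ u × possibleValues μ σ u =>
      dTV (condMarginal μ (pin σ ∩ {x | x u = p.1}) v)
        (condMarginal μ (pin σ ∩ {x | x u = p.2}) v))
    (Set.finite_range _).bddAbove (⟨i, hi⟩, ⟨j, hj⟩)

/-- A bound on the all-to-one or the one-to-all influence bounds the pairwise correlations of
centred single-site functions. -/
theorem sum_pair_correlation_le_of_influence [DecidableEq V] {μ : (V → Fin q) → ℝ} (hμ : ∀ x, 0 ≤ μ x)
    {Λ : Finset V} (σ : Λ → Fin q) (hσ : 0 < prob μ (pin σ)) {ρ : ℝ} (hρ : 0 ≤ ρ)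
    (h : allToOne μ σ ≤ ρ ∨ oneToAll μ σ ≤ ρ) (g : {v : V // v ∉ Λ} → Fin q → ℝ)
    (hg : ∀ u : {v : V // v ∉ Λ}, ∑ i, prob μ (pin σ ∩ {x | x u = i}) * g u i = 0) :
    ∑ u : {v : V // v ∉ Λ}, ∑ v : {v : V // v ∉ Λ}, (if u = v then 0 else ∑ i, ∑ j,
        prob μ ({x | x (v : V) = j} ∩ (pin σ ∩ {x | x (u : V) = i})) * g u i * g v j)
      ≤ ρ * ∑ u : {v : V // v ∉ Λ}, ∑ i, prob μ (pin σ ∩ {x | x u = i}) * g u i ^ 2 := by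
  refine sum_pair_correlation_le
    (fun (u : {v : V // v ∉ Λ}) i => prob μ (pin σ ∩ {x | x (u : V) = i}))
    (fun u i => prob_nonneg hμ _) hσ (fun u => sum_sumOn_fiber (pin σ) u fun _ => μ)
    (fun u i v j => prob μ ({x | x (v : V) = j} ∩ (pin σ ∩ {x | x (u : V) = i})))
    ?_ ?_ ?_ (fun u v => influence μ σ u v) (influence_nonneg μ σ) ?_ hρ ?_ g hg
  · intro u i v j
    congr 1
    ext x
    simp only [Set.mem_inter_iff, Set.mem_ofPred_eq]
    tauto
  · intro u v _ i
    simp only [Set.inter_comm {x : V → Fin q | x (v : V) = _}]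
    exact sum_sumOn_fiber _ (v : V) fun _ => μ
  · intro u i v j hv
    refine le_antisymm ?_ (prob_nonneg hμ _)
    rw [← hv]
    refine prob_mono hμ fun x hx => ?_
    exact ⟨hx.2.1, hx.1⟩
  · intro u v huv i j hi hj
    have hmem : ∀ i, 0 < prob μ (pin σ ∩ {x | x (u : V) = i}) → i ∈ possibleValues μ σ u := by
      intro i hi
      rw [possibleValues, Set.mem_ofPred_eq, condMarginal, Set.inter_comm]
      exact div_pos hi hσ
    exact dTV_le_influence μ σ huv (hmem i hi) (hmem j hj)
  · rcases h with h | h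
    · right
      intro v
      refine le_trans ?_ h
      have hsup := le_ciSup (f := fun v : {v : V // v ∉ Λ} => ∑ u, influence μ σ u v)
        (Set.finite_range _).bddAbove v
      rw [allToOne]
      convert hsup using 1
      congr! 3
      ext; simp
    · left
      intro u
      refine le_trans ?_ h
      have hsup := le_ciSup (f := fun u : {v : V // v ∉ Λ} => ∑ v, influence μ σ u v)
        (Set.finite_range _).bddAbove u
      rw [oneToAll]
      convert hsup using 1
      congr! 3
      ext; simp

/-- The contribution of the configuration `x` to the Dirichlet form of heat-bath updates at `v`. -/
noncomputable def siteEnergy (μ f : (V → Fin q) → ℝ) (v : V) (x : V → Fin q) : ℝ :=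
  sumOn (line v x) (fun y => 1 / 2 * (μ x * μ y * (f x - f y) ^ 2)) / prob μ (line v x)

theorem siteEnergy_nonneg {μ : (V → Fin q) → ℝ} (hμ : ∀ x, 0 ≤ μ x) (f : (V → Fin q) → ℝ)
    (v : V) (x : V → Fin q) : 0 ≤ siteEnergy μ f v x :=
  div_nonneg (sumOn_nonneg fun y _ => mul_nonneg (by norm_num)
    (mul_nonneg (mul_nonneg (hμ x) (hμ y)) (sq_nonneg _))) (prob_nonneg hμ _)

/-- On a single line the variance is the Dirichlet form. -/
theorem varOn_line {μ : (V → Fin q) → ℝ} (hμ : ∀ x, 0 ≤ μ x) (f : (V → Fin q) → ℝ)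
    (v : V) (x : V → Fin q) :
    varOn μ (line v x) f = sumOn (line v x) (siteEnergy μ f v) := by
  set B := line v x with hB
  have h1 : ∀ y ∈ B, siteEnergy μ f v y
      = (prob μ B)⁻¹ * (1 / 2 * (prob μ B * (μ y * f y ^ 2)
        + (-2 * sumOn B (fun z => μ z * f z) * (μ y * f y)
        + sumOn B (fun z => μ z * f z ^ 2) * μ y))) := by
    intro y hy
    rw [siteEnergy, line_eq_of_mem hy, ← hB, div_eq_inv_mul]
    congr 1
    rw [sumOn_mul_left]
    congr 1
    have : sumOn B (fun z => μ y * μ z * (f y - f z) ^ 2)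
        = (μ y * f y ^ 2) * sumOn B μ + ((-2 * (μ y * f y)) * sumOn B (fun z => μ z * f z)
          + μ y * sumOn B (fun z => μ z * f z ^ 2)) := by
      rw [← sumOn_mul_left, ← sumOn_mul_left, ← sumOn_mul_left, ← sumOn_add, ← sumOn_add]
      exact sumOn_congr fun z _ => by ring
    rw [this, prob_eq_sumOn]
    ring
  rw [sumOn_congr h1, sumOn_mul_left, sumOn_mul_left, sumOn_add, sumOn_add, sumOn_mul_left,
    sumOn_mul_left, sumOn_mul_left, ← prob_eq_sumOn μ]
  rcases eq_or_ne (prob μ B) 0 with h0 | h0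
  · rw [varOn_eq_zero hμ h0, h0]; simp
  · rw [varOn]
    field_simp
    ring

/-- With `k + 1` free sites, this rewrites the assumed influence bound as `k` times the quantity
entering the product, so that `k` later cancels. -/
theorem min_div_mul {C η : ℝ} {k : ℝ} (hk : 0 < k) : k * min (C / k) η = min C (η * k) := by
  rw [mul_min_of_nonneg _ _ hk.le, mul_div_cancel₀ _ hk.ne', mul_comm η]

/-- The local-to-global theorem: bounded influence under every pinning yields a Poincaré
inequality for single-site updates. -/
theorem prod_mul_varOn_le {μ : (V → Fin q) → ℝ} (hμ : ∀ x, 0 ≤ μ x) {C η : ℝ} (hC : 0 ≤ C)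
    (hη₀ : 0 ≤ η) (hη₁ : η < 1)
    (hinf : ∀ (Λ : Finset V) (σ : Λ → Fin q),
      Λ.card + 2 ≤ Fintype.card V → Feasible μ σ →
        allToOne μ σ ≤ min C (η * ((Fintype.card V : ℝ) - (Λ.card : ℝ) - 1)) ∨
        oneToAll μ σ ≤ min C (η * ((Fintype.card V : ℝ) - (Λ.card : ℝ) - 1)))
    (f : (V → Fin q) → ℝ) [DecidableEq V] (m : ℕ) :
    ∀ (Λ : Finset V) (x : V → Fin q), Λ.card + (m + 1) = Fintype.card V →
      (∏ j ∈ Finset.range m, (1 - min (C / (j + 1)) η)) * varOn μ (cyl Λ x) f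
        ≤ ∑ v ∈ Λᶜ, sumOn (cyl Λ x) (siteEnergy μ f v) := by
  -- There are `m + 1` free sites. With one left, the cylinder is a line and equality holds.
  induction m with
  | zero =>
    intro Λ x hcard
    obtain ⟨v, hv⟩ := Finset.card_eq_one.1
      (show (Λᶜ).card = 1 by rw [Finset.card_compl]; omega)
    have hcyl : cyl Λ x = line v x := by
      have : ∀ w, w ∈ Λ ↔ w ≠ v := by
        intro w
        rw [← not_iff_not, ← Finset.mem_compl, hv]; simp
      ext y
      exact forall_congr' fun w => by rw [this w]
    rw [hv, hcyl, Finset.sum_singleton, Finset.prod_range_zero, one_mul, varOn_line hμ]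
  | succ m ih =>
    intro Λ x hcard
    rcases (prob_nonneg hμ (cyl Λ x)).eq_or_lt with h0 | hpos
    · rw [varOn_eq_zero hμ h0.symm, mul_zero]
      exact Finset.sum_nonneg fun v _ => sumOn_nonneg fun y _ => siteEnergy_nonneg hμ f v y
    have hm : (0 : ℝ) < (m : ℝ) + 1 := by positivity
    have hk : (Fintype.card V : ℝ) - (Λ.card : ℝ) - 1 = (m : ℝ) + 1 := by
      rw [← hcard]; push_cast; ring
    set a : ℝ := min (C / ((m : ℝ) + 1)) η with ha
    have ha₀ : 0 ≤ a := le_min (div_nonneg hC hm.le) hη₀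
    have hfeas : Feasible μ (fun w : Λ => x w) := by
      by_contra hne
      refine hpos.ne' (le_antisymm ?_ hpos.le)
      classical
      refine Finset.sum_nonpos fun y _ => ?_
      split_ifs with hy
      · rw [cyl_eq_pin] at hy
        exact not_lt.1 fun hlt => hne ⟨y, hlt, hy⟩
      · exact le_rfl
    have hloc := hinf Λ (fun w : Λ => x w) (by omega) hfeas
    rw [hk, ← min_div_mul hm, ← ha] at hloc
    have hρ : 0 ≤ ((m : ℝ) + 1) * a := mul_nonneg hm.le ha₀
    have hpos' := hpos
    rw [cyl_eq_pin] at hpos'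
    have hvar := sum_varOn_sub_le hμ hpos' (fun u : {v : V // v ∉ Λ} => (u : V)) hρ
      (sum_pair_correlation_le_of_influence hμ _ hpos' hρ hloc) f
    rw [← cyl_eq_pin] at hvar
    have hcompl : (Λᶜ).card = m + 2 := by rw [Finset.card_compl]; omega
    rw [← Finset.sum_subtype Λᶜ (fun v => by simp)
      (fun u => varOn μ (cyl Λ x) f - ∑ i, varOn μ (cyl Λ x ∩ {y | y u = i}) f),
      Finset.sum_sub_distrib, Finset.sum_const, hcompl, nsmul_eq_mul] at hvar
    push_cast at hvar
    set γ : ℝ := ∏ j ∈ Finset.range m, (1 - min (C / (j + 1)) η) with hγ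
    have hγ₀ : 0 ≤ γ := Finset.prod_nonneg fun j _ =>
      sub_nonneg.2 ((min_le_right _ _).trans hη₁.le)
    set T : ℝ := ∑ v ∈ Λᶜ, sumOn (cyl Λ x) (siteEnergy μ f v) with hT
    -- Apply the induction hypothesis after pinning each free `u`. Each site `v` then occurs for the
    -- `m + 1` choices `u ≠ v`, whence the factor.
    have hstep : γ * ∑ u ∈ Λᶜ, ∑ i, varOn μ (cyl Λ x ∩ {y | y u = i}) f ≤ ((m : ℝ) + 1) * T := by
      have hu : ∀ u ∈ Λᶜ, γ * ∑ i, varOn μ (cyl Λ x ∩ {y | y u = i}) f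
          ≤ T - sumOn (cyl Λ x) (siteEnergy μ f u) := by
        intro u hu
        have hu' : u ∉ Λ := Finset.mem_compl.1 hu
        have h1 : T - sumOn (cyl Λ x) (siteEnergy μ f u)
            = ∑ i, ∑ v ∈ (insert u Λ)ᶜ, sumOn (cyl Λ x ∩ {y | y u = i}) (siteEnergy μ f v) := by
          rw [Finset.sum_comm, hT, Finset.compl_insert, ← Finset.add_sum_erase _ _ hu,
            add_sub_cancel_left]
          exact Finset.sum_congr rfl fun v _ =>
            (sum_sumOn_fiber (cyl Λ x) u fun _ => siteEnergy μ f v).symm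
        rw [h1, Finset.mul_sum]
        refine Finset.sum_le_sum fun i _ => ?_
        have h2 := ih (insert u Λ) (Function.update x u i)
          (by rw [Finset.card_insert_of_notMem hu']; omega)
        rwa [← cyl_inter Λ x hu' i] at h2
      rw [Finset.mul_sum]
      refine (Finset.sum_le_sum hu).trans (le_of_eq ?_)
      rw [Finset.sum_sub_distrib, Finset.sum_const, hcompl, nsmul_eq_mul, ← hT]
      push_cast
      ring
    rw [Finset.prod_range_succ, ← hγ, ← ha]
    have h3 := mul_le_mul_of_nonneg_left hvar hγ₀
    -- Since `(m + 2) - 1 - (m + 1) a = (m + 1)(1 - a)`, a common factor `m + 1` cancels.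
    nlinarith [h3, hstep]

end LocalToGlobal

/-! ### Reversible chains: from a gap to total variation decay. -/

section ReversibleChain

open Matrix

variable {S : Type*} [Fintype S]

/-- A reversible transition matrix is self-adjoint. -/
theorem sum_mul_mulVec_comm {P : Matrix S S ℝ} {π : S → ℝ}
    (hrev : ∀ x y, π x * P x y = π y * P y x) (a b : S → ℝ) :
    ∑ x, π x * a x * (P *ᵥ b) x = ∑ x, π x * b x * (P *ᵥ a) x := by
  simp only [mulVec, dotProduct, Finset.mul_sum]
  rw [Finset.sum_comm]
  refine Finset.sum_congr rfl fun y _ => Finset.sum_congr rfl fun x _ => ?_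
  linear_combination (a x * b y) * hrev x y

/-- In a reversible chain whose quadratic form is nonnegative and satisfies a Poincaré inequality
with constant `g`, a step contracts the norm of centred functions by `1 - g`. -/
theorem sum_mulVec_sq_le {P : Matrix S S ℝ} {π : S → ℝ}
    (hrev : ∀ x y, π x * P x y = π y * P y x) (hπ : ∀ x, 0 ≤ π x) (hP1 : ∀ x, ∑ y, P x y = 1)
    (hpos : ∀ f : S → ℝ, 0 ≤ ∑ x, π x * f x * (P *ᵥ f) x) {g : ℝ} (hg1 : g ≤ 1)
    (hgap : ∀ f : S → ℝ, ∑ x, π x * f x = 0 →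
      g * ∑ x, π x * f x ^ 2 ≤ ∑ x, π x * f x ^ 2 - ∑ x, π x * f x * (P *ᵥ f) x)
    (f : S → ℝ) (hf : ∑ x, π x * f x = 0) :
    ∑ x, π x * (P *ᵥ f) x = 0 ∧
      ∑ x, π x * (P *ᵥ f) x ^ 2 ≤ (1 - g) ^ 2 * ∑ x, π x * f x ^ 2 := by
  have hsymm := sum_mul_mulVec_comm hrev
  have hmean : ∑ x, π x * (P *ᵥ f) x = 0 := by
    have h := hsymm 1 f
    have h1 : P *ᵥ (1 : S → ℝ) = 1 := by
      ext x; simp [mulVec, dotProduct, hP1]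
    rw [h1] at h
    simpa [hf] using h
  refine ⟨hmean, ?_⟩
  set h : S → ℝ := P *ᵥ f with hh
  have hN : 0 ≤ ∑ x, π x * h x ^ 2 := Finset.sum_nonneg fun x _ => mul_nonneg (hπ x) (sq_nonneg _)
  have h1 : ∑ x, π x * f x * (P *ᵥ h) x = ∑ x, π x * h x ^ 2 := by
    rw [hsymm f h]
    exact Finset.sum_congr rfl fun x _ => by rw [← hh]; ring
  have h2 := hgap f hf
  have h3 := hgap h hmean
  -- Positivity of the form at `h - s f`. The choice `s = 1 - g`, with the gap inequality for `f`
  -- and for `h`, gives the contraction without diagonalising `P`.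
  have h4 : ∀ s : ℝ, 0 ≤ ∑ x, π x * h x * (P *ᵥ h) x - 2 * s * (∑ x, π x * h x ^ 2)
      + s ^ 2 * ∑ x, π x * f x * h x := by
    intro s
    have hlin : P *ᵥ (fun x => h x - s * f x) = fun x => (P *ᵥ h) x - s * h x := by
      have : (fun x => h x - s * f x) = h - s • f := by ext x; simp
      rw [this, mulVec_sub, mulVec_smul]
      ext x; simp [hh]
    refine (hpos (fun x => h x - s * f x)).trans (le_of_eq ?_)
    have h5 : ∑ x, π x * (h x - s * f x) * (P *ᵥ fun x => h x - s * f x) x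
        = ∑ x, π x * h x * (P *ᵥ h) x - s * (∑ x, π x * h x ^ 2)
          - s * (∑ x, π x * f x * (P *ᵥ h) x) + s ^ 2 * ∑ x, π x * f x * h x := by
      rw [hlin]
      simp only [Finset.mul_sum, ← Finset.sum_sub_distrib, ← Finset.sum_add_distrib]
      exact Finset.sum_congr rfl fun x _ => by ring
    rw [h5, h1]
    ring
  rw [← hh] at h2
  -- The general case cancels a factor `1 - g`; when `g = 1`, the choice `s = 1` gives `h = 0` in
  -- norm directly.
  rcases hg1.eq_or_lt with rfl | hlt
  · have h7 : ∑ x, π x * f x * h x ≤ 0 := by linarith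
    have h8 := h4 1
    linarith
  · have h6 : (1 - g) ^ 2 * ∑ x, π x * f x * h x
        ≤ (1 - g) ^ 2 * ((1 - g) * ∑ x, π x * f x ^ 2) :=
      mul_le_mul_of_nonneg_left (by linarith) (sq_nonneg _)
    have h7 : 0 < 1 - g := by linarith
    have h8 := h4 (1 - g)
    have h9 : 0 ≤ (1 - g) * ((1 - g) ^ 2 * ∑ x, π x * f x ^ 2 - ∑ x, π x * h x ^ 2) := by
      linarith
    exact sub_nonneg.1 (nonneg_of_mul_nonneg_right h9 h7)

/-- The Dirichlet form of a reversible chain as a sum over transitions. -/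
theorem sum_sq_sub_sum_mulVec {P : Matrix S S ℝ} {π : S → ℝ}
    (hrev : ∀ x y, π x * P x y = π y * P y x) (hP1 : ∀ x, ∑ y, P x y = 1) (f : S → ℝ) :
    ∑ x, π x * f x ^ 2 - ∑ x, π x * f x * (P *ᵥ f) x
      = ∑ x, ∑ y, 1 / 2 * (π x * P x y * (f x - f y) ^ 2) := by
  have h1 : ∑ x, π x * f x ^ 2 = ∑ x, ∑ y, π x * P x y * f x ^ 2 := by
    refine Finset.sum_congr rfl fun x _ => ?_
    rw [← Finset.sum_mul, ← Finset.mul_sum, hP1, mul_one]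
  have h2 : ∑ x, ∑ y, π x * P x y * f x ^ 2 = ∑ x, ∑ y, π x * P x y * f y ^ 2 := by
    rw [Finset.sum_comm]
    exact Finset.sum_congr rfl fun y _ => Finset.sum_congr rfl fun x _ => by rw [hrev]
  have h3 : ∑ x, π x * f x * (P *ᵥ f) x = ∑ x, ∑ y, π x * P x y * f x * f y := by
    simp only [mulVec, dotProduct, Finset.mul_sum]
    exact Finset.sum_congr rfl fun x _ => Finset.sum_congr rfl fun y _ => by ring
  have h4 : ∑ x, ∑ y, 1 / 2 * (π x * P x y * (f x - f y) ^ 2)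
      = 1 / 2 * ∑ x, ∑ y, π x * P x y * f x ^ 2 + 1 / 2 * ∑ x, ∑ y, π x * P x y * f y ^ 2
        - ∑ x, ∑ y, π x * P x y * f x * f y := by
    simp only [Finset.mul_sum, ← Finset.sum_sub_distrib, ← Finset.sum_add_distrib]
    exact Finset.sum_congr rfl fun x _ => Finset.sum_congr rfl fun y _ => by ring
  rw [h4, ← h2, ← h1, h3]
  ring

/-- Geometric convergence in total variation of a reversible chain with a spectral gap. -/
theorem dTV_pow_le [DecidableEq S] {P : Matrix S S ℝ} {π : S → ℝ}
    (hrev : ∀ x y, π x * P x y = π y * P y x) (hπ : ∀ x, 0 < π x) (hπ1 : ∑ x, π x = 1)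
    (hP1 : ∀ x, ∑ y, P x y = 1)
    (hpos : ∀ f : S → ℝ, 0 ≤ ∑ x, π x * f x * (P *ᵥ f) x) {g : ℝ} (hg1 : g ≤ 1)
    (hgap : ∀ f : S → ℝ, ∑ x, π x * f x = 0 →
      g * ∑ x, π x * f x ^ 2 ≤ ∑ x, π x * f x ^ 2 - ∑ x, π x * f x * (P *ᵥ f) x)
    (x : S) (t : ℕ) :
    dTV ((P ^ t) x) π ≤ 1 / 2 * ((1 - g) ^ t * √(1 / π x - 1)) := by
  -- By reversibility the density of `P ^ t` relative to `π` evolves under `P` itself; its initial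
  -- variance is `1 / π x - 1`.
  have hdens : ∀ t : ℕ, ∑ y, π y * ((P ^ t) x y / π y - 1) = 0 ∧
      ∑ y, π y * ((P ^ t) x y / π y - 1) ^ 2 ≤ ((1 - g) ^ t) ^ 2 * (1 / π x - 1) := by
    intro t
    induction t with
    | zero =>
      have h1 : ∀ y, π y * ((P ^ 0) x y / π y - 1) = (1 : Matrix S S ℝ) x y - π y := by
        intro y
        have := (hπ y).ne'
        rw [pow_zero]; field_simp
      have h2 : ∀ y, π y * ((P ^ 0) x y / π y - 1) ^ 2
          = (1 : Matrix S S ℝ) x y * (1 / π x - 2) + π y := by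
        intro y
        have := (hπ y).ne'
        have := (hπ x).ne'
        rw [pow_zero]
        by_cases hxy : x = y
        · subst hxy
          rw [one_apply_eq]; field_simp; ring
        · rw [one_apply_ne hxy]; simp
      have h3 : ∑ y, (1 : Matrix S S ℝ) x y = 1 := by simp [one_apply]
      simp only [h1, h2]
      rw [Finset.sum_sub_distrib, Finset.sum_add_distrib, ← Finset.sum_mul, h3, hπ1]
      refine ⟨by ring, le_of_eq (by ring)⟩
    | succ t ih =>
      have hstep : ∀ y, (P ^ (t + 1)) x y / π y - 1
          = (P *ᵥ fun y => (P ^ t) x y / π y - 1) y := by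
        intro y
        simp only [mulVec, dotProduct, mul_sub, mul_one, Finset.sum_sub_distrib, hP1]
        rw [pow_succ, mul_apply, Finset.sum_div]
        congr 1
        refine Finset.sum_congr rfl fun z _ => ?_
        have h1 := (hπ y).ne'
        have h2 := (hπ z).ne'
        have h3 := hrev z y
        field_simp
        linear_combination ((P ^ t) x z) * h3
      obtain ⟨h1, h2⟩ := sum_mulVec_sq_le hrev (fun x => (hπ x).le) hP1 hpos hg1 hgap _ ih.1
      simp only [hstep]
      refine ⟨h1, h2.trans ?_⟩
      calc _ ≤ (1 - g) ^ 2 * (((1 - g) ^ t) ^ 2 * (1 / π x - 1)) :=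
            mul_le_mul_of_nonneg_left ih.2 (sq_nonneg _)
        _ = _ := by ring
  rw [dTV]
  refine mul_le_mul_of_nonneg_left ?_ (by norm_num)
  have hg0 : 0 ≤ (1 - g) ^ t := pow_nonneg (by linarith) t
  have hcs : (∑ y, |(P ^ t) x y - π y|) ^ 2
      ≤ (∑ y, π y) * ∑ y, π y * ((P ^ t) x y / π y - 1) ^ 2 := by
    refine Finset.sum_sq_le_sum_mul_sum_of_sq_le_mul _ (fun y _ => (hπ y).le)
      (fun y _ => mul_nonneg (hπ y).le (sq_nonneg _)) fun y _ => ?_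
    have := (hπ y).ne'
    refine le_of_eq ?_
    rw [sq_abs]; field_simp
  rw [hπ1, one_mul] at hcs
  have h := Real.le_sqrt_of_sq_le (hcs.trans (hdens t).2)
  rwa [Real.sqrt_mul (sq_nonneg _), Real.sqrt_sq hg0] at h

end ReversibleChain

/-! ### Glauber dynamics as an average of heat-bath projections. -/

section Glauber

open Matrix

variable {V : Type*} [Fintype V] {q : ℕ}

open scoped Classical in
/-- The heat-bath update at the site `v`. -/
noncomputable def heatBath (μ : (V → Fin q) → ℝ) (v : V) : Matrix (Supp μ) (Supp μ) ℝ :=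
  fun x y => if y.1 ∈ line v x.1 then μ y / prob μ (line v x.1) else 0

theorem glauber_apply (μ : (V → Fin q) → ℝ) (x y : Supp μ) :
    glauber μ x y = 1 / (Fintype.card V : ℝ) * ∑ v, heatBath μ v x y := by
  classical
  rw [glauber]
  congr 1
  refine Finset.sum_congr rfl fun v _ => ?_
  rw [heatBath]
  by_cases h : y.1 ∈ line v x.1
  · rw [if_pos h, if_pos (show ∀ w, w ≠ v → y.1 w = x.1 w from h), condMarginal]
    congr 1
    have hset : ∀ z : V → Fin q,
        z ∈ {z | z v = y.1 v} ∩ {z | ∀ w, w ≠ v → z w = x.1 w} ↔ y.1 = z := by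
      intro z
      constructor
      · rintro ⟨h1, h2⟩
        ext w
        by_cases hw : w = v
        · subst hw; exact congrArg _ (Eq.symm h1)
        · rw [h w hw]; exact congrArg _ (h2 w hw).symm
      · rintro rfl
        exact ⟨rfl, h⟩
    rw [prob]
    simp only [hset, Finset.sum_ite_eq, Finset.mem_univ, if_true]
  · rw [if_neg h, if_neg (show ¬ ∀ w, w ≠ v → y.1 w = x.1 w from h)]

open scoped Classical in
theorem sum_supp {μ : (V → Fin q) → ℝ} (hμ : ∀ x, 0 ≤ μ x) (F : (V → Fin q) → ℝ)
    (hF : ∀ x, μ x = 0 → F x = 0) : ∑ x : Supp μ, F x = ∑ x, F x := by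
  rw [← Finset.sum_subtype (Finset.univ.filter fun x => 0 < μ x) (by simp) F]
  refine Finset.sum_filter_of_ne fun x _ hx => ?_
  exact lt_of_le_of_ne (hμ x) fun h => hx (hF x h.symm)

theorem prob_line_pos {μ : (V → Fin q) → ℝ} (hμ : ∀ x, 0 ≤ μ x) (v : V) (x : Supp μ) :
    0 < prob μ (line v x.1) := by
  classical
  refine x.2.trans_le ?_
  have h := Finset.single_le_sum (f := fun z => if z ∈ line v x.1 then μ z else 0)
    (fun z _ => by split_ifs; exacts [hμ z, le_rfl]) (Finset.mem_univ x.1)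
  rw [if_pos (mem_line_self v x.1)] at h
  exact h

theorem heatBath_reversible (μ : (V → Fin q) → ℝ) (v : V) (x y : Supp μ) :
    μ x * heatBath μ v x y = μ y * heatBath μ v y x := by
  classical
  rw [heatBath, heatBath]
  by_cases h : y.1 ∈ line v x.1
  · rw [if_pos h, if_pos (mem_line_comm.1 h), line_eq_of_mem h]
    ring
  · rw [if_neg h, if_neg (fun h' => h (mem_line_comm.1 h'))]
    ring

open scoped Classical in
theorem sum_heatBath {μ : (V → Fin q) → ℝ} (hμ : ∀ x, 0 ≤ μ x) (v : V) (x : Supp μ) :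
    ∑ y, heatBath μ v x y = 1 := by
  simp only [heatBath]
  rw [sum_supp hμ (fun y => if y ∈ line v x.1 then μ y / prob μ (line v x.1) else 0)
    (fun y hy => by simp [hy])]
  have : ∀ y, (if y ∈ line v x.1 then μ y / prob μ (line v x.1) else 0)
      = (if y ∈ line v x.1 then μ y else 0) / prob μ (line v x.1) := fun y => by
    split_ifs <;> simp
  simp only [this]
  rw [← Finset.sum_div]
  exact div_self (prob_line_pos hμ v x).ne'

-- A heat-bath row depends only on the line of its state, so a second resampling of the same site
-- changes nothing.
open scoped Classical in
theorem heatBath_mul_self {μ : (V → Fin q) → ℝ} (hμ : ∀ x, 0 ≤ μ x) (v : V) :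
    heatBath μ v * heatBath μ v = heatBath μ v := by
  ext x z
  have h : ∀ y, heatBath μ v x y * heatBath μ v y z = heatBath μ v x y * heatBath μ v x z := by
    intro y
    by_cases hy : y.1 ∈ line v x.1
    · congr 1
      simp only [heatBath, line_eq_of_mem hy]
    · simp [heatBath, hy]
  rw [mul_apply]
  simp only [h]
  rw [← Finset.sum_mul, sum_heatBath hμ, one_mul]

-- A self-adjoint idempotent is an orthogonal projection, so `⟨f, P f⟩ = ‖P f‖²`.
open scoped Classical in
theorem heatBath_form_nonneg {μ : (V → Fin q) → ℝ} (hμ : ∀ x, 0 ≤ μ x) (v : V)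
    (f : Supp μ → ℝ) : 0 ≤ ∑ x : Supp μ, μ x * f x * (heatBath μ v *ᵥ f) x := by
  have h := sum_mul_mulVec_comm (π := fun x : Supp μ => μ x) (heatBath_reversible μ v) f
    (heatBath μ v *ᵥ f)
  rw [mulVec_mulVec, heatBath_mul_self hμ] at h
  rw [h]
  refine Finset.sum_nonneg fun x _ => ?_
  rw [mul_assoc]
  exact mul_nonneg (hμ x) (mul_self_nonneg _)

theorem glauber_reversible (μ : (V → Fin q) → ℝ) (x y : Supp μ) :
    μ x * glauber μ x y = μ y * glauber μ y x := by
  rw [glauber_apply, glauber_apply, mul_left_comm, mul_left_comm (μ y)]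
  congr 1
  rw [Finset.mul_sum, Finset.mul_sum]
  exact Finset.sum_congr rfl fun v _ => heatBath_reversible μ v x y

open scoped Classical in
theorem sum_glauber [Nonempty V] {μ : (V → Fin q) → ℝ} (hμ : ∀ x, 0 ≤ μ x) (x : Supp μ) :
    ∑ y, glauber μ x y = 1 := by
  simp only [glauber_apply]
  rw [← Finset.mul_sum, Finset.sum_comm]
  simp only [sum_heatBath hμ]
  simp

open scoped Classical in
theorem glauber_form (μ : (V → Fin q) → ℝ) (f : Supp μ → ℝ) :
    ∑ x : Supp μ, μ x * f x * (glauber μ *ᵥ f) x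
      = 1 / (Fintype.card V : ℝ) * ∑ v, ∑ x : Supp μ, μ x * f x * (heatBath μ v *ᵥ f) x := by
  rw [Finset.sum_comm, Finset.mul_sum]
  refine Finset.sum_congr rfl fun x _ => ?_
  rw [← Finset.mul_sum, mul_left_comm]
  congr 1
  simp only [mulVec, dotProduct, glauber_apply]
  rw [Finset.sum_comm, Finset.mul_sum]
  refine Finset.sum_congr rfl fun y _ => ?_
  rw [mul_assoc, Finset.sum_mul]

open scoped Classical in
/-- The Dirichlet form of a heat-bath update, for a function given on all configurations. -/
theorem heatBath_dirichlet {μ : (V → Fin q) → ℝ} (hμ : ∀ x, 0 ≤ μ x) (v : V)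
    (f : (V → Fin q) → ℝ) :
    ∑ x : Supp μ, μ x * f x ^ 2
        - ∑ x : Supp μ, μ x * f x * (heatBath μ v *ᵥ fun x => f x) x
      = sumOn Set.univ (siteEnergy μ f v) := by
  rw [sum_sq_sub_sum_mulVec (π := fun x : Supp μ => μ x) (heatBath_reversible μ v)
    (sum_heatBath hμ v)]
  have h1 : sumOn Set.univ (siteEnergy μ f v) = ∑ x, siteEnergy μ f v x := by simp [sumOn]
  rw [h1, ← sum_supp hμ (siteEnergy μ f v) (fun x hx => by simp [siteEnergy, hx, sumOn])]
  refine Finset.sum_congr rfl fun x _ => ?_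
  rw [siteEnergy, sumOn, ← sum_supp hμ _ (fun y hy => by simp [hy]), Finset.sum_div]
  refine Finset.sum_congr rfl fun y _ => ?_
  rw [heatBath]
  split_ifs
  · ring
  · simp

open scoped Classical in
/-- The Poincaré inequality for Glauber dynamics under bounded influence. -/
theorem glauber_gap [Nonempty V] {μ : (V → Fin q) → ℝ} (hμ : IsDistribution μ) {C η : ℝ}
    (hC : 0 ≤ C) (hη₀ : 0 ≤ η) (hη₁ : η < 1)
    (hinf : ∀ (Λ : Finset V) (σ : Λ → Fin q),
      Λ.card + 2 ≤ Fintype.card V → Feasible μ σ →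
        allToOne μ σ ≤ min C (η * ((Fintype.card V : ℝ) - (Λ.card : ℝ) - 1)) ∨
        oneToAll μ σ ≤ min C (η * ((Fintype.card V : ℝ) - (Λ.card : ℝ) - 1)))
    (f : Supp μ → ℝ) (hf : ∑ x : Supp μ, μ x * f x = 0) :
    ((∏ j ∈ Finset.range (Fintype.card V - 1), (1 - min (C / (j + 1)) η)) / Fintype.card V)
        * ∑ x : Supp μ, μ x * f x ^ 2
      ≤ ∑ x : Supp μ, μ x * f x ^ 2 - ∑ x : Supp μ, μ x * f x * (glauber μ *ᵥ f) x := by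
  obtain ⟨hμ₀, hμ₁⟩ := hμ
  -- Extension by zero off the support, because the local-to-global inequality concerns functions of
  -- all configurations.
  obtain ⟨F, hF⟩ : ∃ F : (V → Fin q) → ℝ, ∀ x : Supp μ, F x = f x :=
    ⟨fun x => if h : 0 < μ x then f ⟨x, h⟩ else 0, fun x => by simp [x.2]⟩
  have hn : (0 : ℝ) < Fintype.card V := by exact_mod_cast Fintype.card_pos
  have hne : Nonempty (V → Fin q) := by
    by_contra hne
    rw [not_nonempty_iff] at hne
    simp at hμ₁
  obtain ⟨x₀⟩ := hne
  have h := prod_mul_varOn_le hμ₀ hC hη₀ hη₁ hinf F (Fintype.card V - 1) ∅ x₀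
    (by have := Fintype.card_pos (α := V); simp; omega)
  have hcyl : cyl ∅ x₀ = Set.univ := by ext; simp [cyl]
  have hsum : ∀ G : (V → Fin q) → ℝ, sumOn Set.univ (fun x => μ x * G x)
      = ∑ x : Supp μ, μ x * G x := by
    intro G
    rw [sum_supp hμ₀ (fun x => μ x * G x) (fun x hx => by simp [hx])]
    simp [sumOn]
  have hvar : varOn μ Set.univ F = ∑ x : Supp μ, μ x * f x ^ 2 := by
    rw [varOn, hsum (fun x => F x ^ 2), hsum F]
    simp only [hF]
    rw [hf]
    simp
  rw [hcyl, hvar, Finset.compl_empty] at h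
  simp only [← heatBath_dirichlet hμ₀, hF] at h
  rw [Finset.sum_sub_distrib, Finset.sum_const, Finset.card_univ, nsmul_eq_mul] at h
  rw [glauber_form, div_mul_eq_mul_div, div_le_iff₀ hn]
  refine h.trans (le_of_eq ?_)
  rw [sub_mul, one_div, mul_right_comm, inv_mul_cancel₀ hn.ne', one_mul, mul_comm]

end Glauber

/-! ### Closed form of the gap and the number of steps. -/

section MixingBound

/-- With `y = C / k ≤ 1/2`, the left side is at most `exp(-2y) ≤ 1 / (1 + 2y)`, and `(1 - y)(1 + 2y)
= 1 + y(1 - 2y) ≥ 1`. -/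
theorem one_sub_inv_rpow_le {C k : ℝ} (hk : 1 < k) (hC : 0 ≤ C) (hCk : 2 * C ≤ k) :
    (1 - 1 / k) ^ (2 * C) ≤ 1 - C / k := by
  have hk0 : 0 < k := by linarith
  have hx0 : 0 ≤ C / k := div_nonneg hC hk0.le
  have hx1 : C / k ≤ 1 / 2 := by rw [div_le_iff₀ hk0]; linarith
  have h1 : (1 - 1 / k) ^ (2 * C) ≤ Real.exp (-(1 / k)) ^ (2 * C) :=
    Real.rpow_le_rpow (sub_nonneg.2 ((div_le_one hk0).2 hk.le)) (Real.one_sub_le_exp_neg _)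
      (by linarith)
  have h2 : Real.exp (-(1 / k)) ^ (2 * C) = Real.exp (-(2 * (C / k))) := by
    rw [← Real.exp_mul]; congr 1; ring
  have h3 : Real.exp (-(2 * (C / k))) * Real.exp (2 * (C / k)) = 1 := by
    rw [← Real.exp_add]; simp
  have h4 := Real.add_one_le_exp (2 * (C / k))
  have h5 := Real.exp_pos (-(2 * (C / k)))
  rw [h2] at h1
  refine h1.trans ?_
  have h6 : Real.exp (-(2 * (C / k))) * (2 * (C / k) + 1) ≤ 1 := by
    exact (mul_le_mul_of_nonneg_left h4 h5.le).trans h3.le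
  nlinarith [mul_nonneg hx0 (sub_nonneg.2 hx1)]

/-- The exponent counts the factors estimated by `1 - η`. It stops growing once the index exceeds
`2C + 1`; from there each factor is at least `((k - 1)/k)^(2C)` and the growth of the power absorbs
it. The first factor always pays `1 - η`, as `1 - 1/k` vanishes at `k = 1`; hence `2C + 1`. -/
theorem rpow_min_le_prod {C η : ℝ} (hC : 0 ≤ C) (hη₀ : 0 ≤ η) (hη₁ : η < 1) (N : ℕ) :
    (1 - η) ^ min ((N : ℝ) + 1) (2 * C + 1)
      ≤ (∏ j ∈ Finset.range (N + 1), (1 - min (C / (j + 1)) η)) * ((N : ℝ) + 1) ^ (2 * C) := by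
  have h0 : 0 < 1 - η := by linarith
  induction N with
  | zero =>
    have : min (((0 : ℕ) : ℝ) + 1) (2 * C + 1) = 1 := by
      rw [min_eq_left]; all_goals simp [hC]
    rw [this]
    have := min_le_right C η
    simp only [Real.rpow_one, zero_add, Finset.prod_range_one, Nat.cast_zero, div_one,
      Real.one_rpow, mul_one]
    linarith
  | succ N ih =>
    rw [Finset.prod_range_succ]
    push_cast
    set γ := ∏ j ∈ Finset.range (N + 1), (1 - min (C / (j + 1)) η) with hγ
    have hγ₀ : 0 ≤ γ := Finset.prod_nonneg fun j _ =>
      sub_nonneg.2 ((min_le_right _ _).trans hη₁.le)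
    have hN : (0 : ℝ) ≤ N := Nat.cast_nonneg N
    have hb : 1 - η ≤ 1 - min (C / ((N : ℝ) + 1 + 1)) η := by
      linarith [min_le_right (C / ((N : ℝ) + 1 + 1)) η]
    have hb' : 1 - C / ((N : ℝ) + 1 + 1) ≤ 1 - min (C / ((N : ℝ) + 1 + 1)) η := by
      linarith [min_le_left (C / ((N : ℝ) + 1 + 1)) η]
    set b := 1 - min (C / ((N : ℝ) + 1 + 1)) η with hbdef
    have hmono : ((N : ℝ) + 1) ^ (2 * C) ≤ ((N : ℝ) + 1 + 1) ^ (2 * C) :=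
      Real.rpow_le_rpow (by linarith) (by linarith) (by linarith)
    have hpow : 0 ≤ ((N : ℝ) + 1) ^ (2 * C) := Real.rpow_nonneg (by linarith) _
    rcases le_or_gt ((N : ℝ) + 1 + 1) (2 * C + 1) with hc | hc
    · rw [min_eq_left hc, Real.rpow_add h0, Real.rpow_one]
      rw [min_eq_left (by linarith)] at ih
      calc (1 - η) ^ ((N : ℝ) + 1) * (1 - η) ≤ (γ * ((N : ℝ) + 1) ^ (2 * C)) * b :=
            mul_le_mul ih hb h0.le (mul_nonneg hγ₀ hpow)
        _ = γ * b * ((N : ℝ) + 1) ^ (2 * C) := by ring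
        _ ≤ _ := mul_le_mul_of_nonneg_left hmono (mul_nonneg hγ₀ (h0.le.trans hb))
    · have h1 : (1 - η) ^ min ((N : ℝ) + 1 + 1) (2 * C + 1)
          ≤ (1 - η) ^ min ((N : ℝ) + 1) (2 * C + 1) :=
        Real.rpow_le_rpow_of_exponent_ge h0 (by linarith)
          (min_le_min_right _ (by linarith))
      have h2 : ((N : ℝ) + 1) ^ (2 * C) ≤ b * ((N : ℝ) + 1 + 1) ^ (2 * C) := by
        have h3 : (N : ℝ) + 1 = (1 - 1 / ((N : ℝ) + 1 + 1)) * ((N : ℝ) + 1 + 1) := by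
          field_simp; ring
        conv_lhs => rw [h3]
        rw [Real.mul_rpow (sub_nonneg.2 ((div_le_one (by linarith)).2 (by linarith)))
          (by linarith)]
        exact mul_le_mul_of_nonneg_right
          ((one_sub_inv_rpow_le (by linarith) hC (by linarith)).trans hb')
          (Real.rpow_nonneg (by linarith) _)
      refine h1.trans (ih.trans ?_)
      rw [mul_assoc]
      exact mul_le_mul_of_nonneg_left h2 hγ₀

/-- The lower bound on the spectral gap, in closed form. -/
theorem closed_form_le_prod_div {C η : ℝ} (hC : 0 ≤ C) (hη₀ : 0 ≤ η) (hη₁ : η < 1) {n : ℕ}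
    (hn : 0 < n) :
    (1 - η) ^ (2 + 2 * C) / (n : ℝ) ^ (1 + 2 * C)
      ≤ (∏ j ∈ Finset.range (n - 1), (1 - min (C / (j + 1)) η)) / n := by
  have h0 : 0 < 1 - η := by linarith
  have hn' : (0 : ℝ) < n := by exact_mod_cast hn
  have hp : (0 : ℝ) < (n : ℝ) ^ (2 * C) := Real.rpow_pos_of_pos hn' _
  have key : (1 - η) ^ (2 + 2 * C)
      ≤ (∏ j ∈ Finset.range (n - 1), (1 - min (C / (j + 1)) η)) * (n : ℝ) ^ (2 * C) := by
    obtain ⟨m, rfl⟩ : ∃ m, n = m + 1 := ⟨n - 1, by omega⟩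
    rw [Nat.add_sub_cancel]
    rcases m with _ | N
    · simpa using Real.rpow_le_one h0.le (by linarith) (by linarith)
    -- The exponent `2C + 1` would suffice; `2 + 2C` is weaker because `1 - η ≤ 1`.
    · refine (Real.rpow_le_rpow_of_exponent_ge h0 (by linarith)
        ((min_le_right _ _).trans (by linarith))).trans
        ((rpow_min_le_prod hC hη₀ hη₁ N).trans ?_)
      refine mul_le_mul_of_nonneg_left (Real.rpow_le_rpow (by positivity) ?_ (by linarith))
        (Finset.prod_nonneg fun j _ => sub_nonneg.2 ((min_le_right _ _).trans hη₁.le))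
      push_cast; linarith
  rw [Real.rpow_add hn', Real.rpow_one, div_le_div_iff₀ (mul_pos hn' hp) hn']
  calc _ ≤ _ := mul_le_mul_of_nonneg_right key hn'.le
    _ = _ := by ring

/-- After `⌊g⁻¹ log (1 / (ε m))⌋` steps the geometric bound is at most `ε`. -/
theorem decay_le {g ε m p : ℝ} (hg : 0 < g) (hg1 : g ≤ 1) (hε : 0 < ε) (hm : 0 < m)
    (hmp : m ≤ p) :
    1 / 2 * ((1 - g) ^ ⌊g⁻¹ * Real.log (1 / (ε * m))⌋₊ * √(1 / p - 1)) ≤ ε := by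
  set L := Real.log (1 / (ε * m)) with hL
  set t := ⌊g⁻¹ * L⌋₊ with ht
  -- Rounding down loses at most one step, that is a factor `e`. It is recovered from `m √(1/p - 1)
  -- ≤ √(m(1 - m)) ≤ 1/2` and the `1/2` in total variation, as `e ≤ 4`.
  have h1 : (1 - g) ^ t ≤ ε * m * Real.exp 1 := by
    calc (1 - g) ^ t ≤ Real.exp (-g) ^ t :=
          pow_le_pow_left₀ (by linarith) (Real.one_sub_le_exp_neg g) t
      _ = Real.exp (-(g * t)) := by rw [← Real.exp_nat_mul]; congr 1; ring
      _ ≤ Real.exp (-L + 1) := by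
          refine Real.exp_le_exp.2 ?_
          have h2 : g * (g⁻¹ * L) < g * (t + 1) :=
            mul_lt_mul_of_pos_left (Nat.lt_floor_add_one _) hg
          rw [mul_inv_cancel_left₀ hg.ne'] at h2
          linarith
      _ = ε * m * Real.exp 1 := by
          rw [Real.exp_add, hL, Real.exp_neg, Real.exp_log (by positivity)]
          simp
  have h2 : m * √(1 / p - 1) ≤ 1 / 2 := by
    have h3 : m * √(1 / p - 1) = √(m ^ 2 * (1 / p - 1)) := by
      rw [Real.sqrt_mul (sq_nonneg _), Real.sqrt_sq hm.le]
    rw [h3, Real.sqrt_le_left (by norm_num)]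
    have h4 : m ^ 2 * (1 / p - 1) ≤ m ^ 2 * (1 / m - 1) :=
      mul_le_mul_of_nonneg_left (sub_le_sub_right (one_div_le_one_div_of_le hm hmp) _)
        (sq_nonneg _)
    have h5 : m ^ 2 * (1 / m - 1) = m - m ^ 2 := by field_simp
    nlinarith [sq_nonneg (m - 1 / 2)]
  calc 1 / 2 * ((1 - g) ^ t * √(1 / p - 1))
      ≤ 1 / 2 * ((ε * m * Real.exp 1) * √(1 / p - 1)) := by gcongr
    _ = 1 / 2 * ε * Real.exp 1 * (m * √(1 / p - 1)) := by ring
    _ ≤ 1 / 2 * ε * 4 * (1 / 2) := by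
        have := Real.exp_one_lt_d9
        have h6 : Real.exp 1 ≤ 4 := by linarith
        gcongr
    _ = ε := by ring

end MixingBound

/-- Mixing time bound for Glauber dynamics under bounded influence. -/
theorem exists_mixingTime_eq_le {V : Type*} [Fintype V] [Nonempty V] {q : ℕ}
    (μ : (V → Fin q) → ℝ) (hμ : IsDistribution μ)
    (C η : ℝ) (hC : 0 ≤ C) (hη₀ : 0 ≤ η) (hη₁ : η < 1)
    (hinf : ∀ (Λ : Finset V) (σ : Λ → Fin q),
      Λ.card + 2 ≤ Fintype.card V → Feasible μ σ →
        allToOne μ σ ≤ min C (η * ((Fintype.card V : ℝ) - (Λ.card : ℝ) - 1)) ∨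
        oneToAll μ σ ≤ min C (η * ((Fintype.card V : ℝ) - (Λ.card : ℝ) - 1)))
    (ε : ℝ) (hε₀ : 0 < ε) (hε₁ : ε < 1) :
    ∃ T : ℕ, mixingTime μ ε = (T : ℕ∞) ∧
      (T : ℝ) ≤ (Fintype.card V : ℝ) ^ (1 + 2 * C) / (1 - η) ^ (2 + 2 * C) *
        Real.log (1 / (ε * muMin μ)) := by
  classical
  have h0 : 0 < 1 - η := by linarith
  have hn : 0 < Fintype.card V := Fintype.card_pos
  have hn' : (1 : ℝ) ≤ Fintype.card V := by exact_mod_cast hn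
  have hsum : ∑ x : Supp μ, μ x = 1 := by
    rw [sum_supp hμ.1 μ fun _ h => h]; exact hμ.2
  have : Nonempty (Supp μ) := by
    by_contra hne
    rw [not_nonempty_iff] at hne
    simp at hsum
  have hmin : ∀ x : Supp μ, muMin μ ≤ μ x := fun x =>
    ciInf_le (Set.finite_range fun x : Supp μ => μ x).bddBelow x
  obtain ⟨x₁, hx₁⟩ := exists_eq_ciInf_of_finite (f := fun x : Supp μ => μ x)
  have hm0 : 0 < muMin μ := by rw [muMin, ← hx₁]; exact x₁.2
  have hm1 : muMin μ ≤ 1 := (hmin x₁).trans (by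
    rw [← hsum]
    exact Finset.single_le_sum (f := fun x : Supp μ => μ x) (fun x _ => x.2.le)
      (Finset.mem_univ x₁))
  set g : ℝ := (1 - η) ^ (2 + 2 * C) / (Fintype.card V : ℝ) ^ (1 + 2 * C) with hg
  have hg0 : 0 < g := div_pos (Real.rpow_pos_of_pos h0 _) (Real.rpow_pos_of_pos (by linarith) _)
  have hg1 : g ≤ 1 := div_le_one_of_le₀
    ((Real.rpow_le_one h0.le (by linarith) (by linarith)).trans
      (Real.one_le_rpow hn' (by linarith))) (Real.rpow_nonneg (by linarith) _)
  have hbound : (Fintype.card V : ℝ) ^ (1 + 2 * C) / (1 - η) ^ (2 + 2 * C) = g⁻¹ := by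
    rw [hg, inv_div]
  rw [hbound]
  have hX : 0 ≤ g⁻¹ * Real.log (1 / (ε * muMin μ)) :=
    mul_nonneg (inv_nonneg.2 hg0.le) (Real.log_nonneg
      ((one_le_div (mul_pos hε₀ hm0)).2 (mul_le_one₀ hε₁.le hm0.le hm1)))
  set t := ⌊g⁻¹ * Real.log (1 / (ε * muMin μ))⌋₊ with ht
  -- The same `t` works from every starting state, which also makes the mixing time finite.
  have hmix : mixingTime μ ε ≤ (t : ℕ∞) := by
    refine iSup_le fun x => ?_
    refine iInf_le_of_le ⟨t, ?_⟩ le_rfl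
    refine (dTV_pow_le (π := fun y : Supp μ => μ y) (glauber_reversible μ) (fun y => y.2) hsum
      (sum_glauber hμ.1) ?_ hg1 ?_ x t).trans (decay_le hg0 hg1 hε₀ hm0 (hmin x))
    · intro f
      rw [glauber_form]
      exact mul_nonneg (by positivity) (Finset.sum_nonneg fun v _ =>
        heatBath_form_nonneg hμ.1 v f)
    · intro f hf
      refine le_trans (mul_le_mul_of_nonneg_right (closed_form_le_prod_div hC hη₀ hη₁ hn)
        (Finset.sum_nonneg fun x _ => mul_nonneg x.2.le (sq_nonneg _))) ?_
      exact glauber_gap hμ hC hη₀ hη₁ hinf f hf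
  obtain ⟨T, hT⟩ := ENat.ne_top_iff_exists.1 (ne_top_of_le_ne_top (ENat.natCast_ne_top t) hmix)
  refine ⟨T, hT.symm, ?_⟩
  rw [← hT] at hmix
  have hTt : T ≤ t := by exact_mod_cast hmix
  exact (Nat.cast_le.2 hTt).trans (Nat.floor_le hX)

end SpinSystem

theorem corollary1p4 {V : Type*} [Fintype V] [Nonempty V] {q : ℕ}
    (μ : (V → Fin q) → ℝ) (hμ : SpinSystem.IsDistribution μ)
    (C η : ℝ) (hC : 0 ≤ C) (hη₀ : 0 ≤ η) (hη₁ : η < 1)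
    (hinf : ∀ (Λ : Finset V) (σ : Λ → Fin q),
      Λ.card + 2 ≤ Fintype.card V → SpinSystem.Feasible μ σ →
        SpinSystem.allToOne μ σ ≤ min C (η * ((Fintype.card V : ℝ) - (Λ.card : ℝ) - 1)) ∨
        SpinSystem.oneToAll μ σ ≤ min C (η * ((Fintype.card V : ℝ) - (Λ.card : ℝ) - 1)))
    (ε : ℝ) (hε₀ : 0 < ε) (hε₁ : ε < 1) :
    ∃ T : ℕ, SpinSystem.mixingTime μ ε = (T : ℕ∞) ∧
      (T : ℝ) ≤ (Fintype.card V : ℝ) ^ (1 + 2 * C) / (1 - η) ^ (2 + 2 * C) *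
        Real.log (1 / (ε * SpinSystem.muMin μ)) :=
  SpinSystem.exists_mixingTime_eq_le μ hμ C η hC hη₀ hη₁ hinf ε hε₀ hε₁
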